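/- Let $q$ be an indeterminate. For integers $0 \le k \le m$ let $\begin{bmatrix} m \\ k \end{bmatrix}_q = \frac{(q;q)_m}{(q;q)_k\,(q;q)_{m-k}}$ be the Gaussian $q$-binomial coefficient, a polynomial in $\mathbb{Z}[q]$, where $(q;q)_m = (1-q)(1-q^2)\cdots(1-q^m)$ and $(q;q)_0=1$. Let $\Phi_n(q)$ be the $n$th cyclotomic polynomial and let $\left(\frac{\cdot}{3}\right)$ be the Legendre symbol modulo $3$. Then for every positive integer $n$, in $\mathbb{Z}[q]$, $$\sum_{k=0}^{n-1} q^k \begin{bmatrix} 2k \\ k \end{bmatrix}_q \equiv \left(\frac{n}{3}\right) q^{\frac{n^2-1}{3}} \pmod{\Phi_n(q)^2},$$ where the right-hand side is understood to be $0$ when $3 \mid n$. -/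

import Mathlib

/-- The `q`-shifted factorial `(a; q)_n = (1 - a) (1 - a q) ⋯ (1 - a q ^ (n - 1))`,
with `(a; q)_0 = 1`. -/
def qShiftedFactorial {K : Type*} [Field K] (a q : K) (n : ℕ) : K :=
  ∏ i ∈ Finset.range n, (1 - a * q ^ i)

/-- The Gaussian `q`-binomial coefficient `[n choose k]_q`, equal to
`(q; q)_n / ((q; q)_k (q; q)_{n - k})` for `0 ≤ k ≤ n` and to `0` otherwise. It is used with
`q` an indeterminate, so that the denominator is nonzero. -/
def qBinomial {K : Type*} [Field K] (q : K) (n k : ℕ) : K :=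
  if k ≤ n then
    qShiftedFactorial q q n / (qShiftedFactorial q q k * qShiftedFactorial q q (n - k))
  else 0

open Polynomial

/-! The sum equals a signed sum of the coefficients `[2n choose n + d]` over `d` prime to 3
(`sum_X_pow_mul_central_gaussBinom`). At a primitive `n`th root of unity `z` these vanish for `1 ≤ d
< n`, so only `d = n` affects the value, and modulo `Φ_n ^ 2` it remains to compare derivatives at
`z`. Writing `z = p ^ 2` with `p ^ n = -1`, the derivative of each vanishing coefficient is explicit
(`derivAt_shiftedCentralGauss`), and the derivative of the sum becomes a block of terms
`thetaQuotient p i` with `i` of both signs. If `3 ∣ n` the block cancels in pairs. Otherwise `r = p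
^ 3` turns it into a sum that, by an identity valid for general `r`, equals a sum of `1 / (1 - r ^
(2 * k))`; the reflection `k ↦ n - k` evaluates that. -/

/-! ### Gaussian binomials as integer polynomials -/

/-- The Gaussian binomial coefficient as an integer polynomial, defined by `q`-Pascal recursion. -/
noncomputable def gaussBinom : ℕ → ℕ → ℤ[X]
  | _, 0 => 1
  | 0, _ + 1 => 0
  | n + 1, k + 1 => gaussBinom n k + X ^ (k + 1) * gaussBinom n (k + 1)

theorem gaussBinom_zero_right (n : ℕ) : gaussBinom n 0 = 1 := by cases n <;> rfl

theorem gaussBinom_succ_succ (n k : ℕ) :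
    gaussBinom (n + 1) (k + 1) = gaussBinom n k + X ^ (k + 1) * gaussBinom n (k + 1) := rfl

theorem gaussBinom_eq_zero_of_lt {n k : ℕ} (h : n < k) : gaussBinom n k = 0 := by
  induction n generalizing k with
  | zero => obtain ⟨k, rfl⟩ := Nat.exists_eq_add_of_lt h; simp [gaussBinom]
  | succ n ih =>
    obtain ⟨k, rfl⟩ : ∃ j, k = j + 1 := ⟨k - 1, by omega⟩
    rw [gaussBinom_succ_succ, ih (by omega), ih (by omega)]; simp

theorem gaussBinom_self (n : ℕ) : gaussBinom n n = 1 := by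
  induction n with
  | zero => rfl
  | succ n ih => rw [gaussBinom_succ_succ, ih, gaussBinom_eq_zero_of_lt (Nat.lt_succ_self n)]; simp

/-- The factor `X ^ k` avoids the truncated exponent `n - k`, so no bound on `k` is needed. -/
theorem X_pow_mul_gaussBinom_succ_right (n k : ℕ) :
    X ^ k * (1 - X ^ (k + 1)) * gaussBinom n (k + 1) = (X ^ k - X ^ n) * gaussBinom n k := by
  induction n generalizing k with
  | zero =>
    rw [gaussBinom_eq_zero_of_lt (Nat.succ_pos k)]
    rcases k with _ | k
    · simp
    · rw [gaussBinom_eq_zero_of_lt (Nat.succ_pos k)]; simp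
  | succ n ih =>
    rcases k with _ | k
    · have := ih 0
      rw [gaussBinom_succ_succ]
      simp only [gaussBinom_zero_right] at this ⊢
      linear_combination X * this
    · rw [gaussBinom_succ_succ, gaussBinom_succ_succ]
      linear_combination X ^ (k + 2) * ih (k + 1) + X * ih k

theorem X_pow_mul_gaussBinom_succ_succ (n k : ℕ) :
    X ^ k * gaussBinom (n + 1) (k + 1) = X ^ k * gaussBinom n (k + 1) + X ^ n * gaussBinom n k := by
  rw [gaussBinom_succ_succ]
  linear_combination -X_pow_mul_gaussBinom_succ_right n k

theorem algebraMap_gaussBinom_mul (k j : ℕ) :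
    algebraMap ℤ[X] (RatFunc ℤ) (gaussBinom (k + j) k) *
      (qShiftedFactorial RatFunc.X RatFunc.X k * qShiftedFactorial RatFunc.X RatFunc.X j) =
    qShiftedFactorial (RatFunc.X : RatFunc ℤ) RatFunc.X (k + j) := by
  induction k generalizing j with
  | zero => simp [gaussBinom_zero_right, qShiftedFactorial]
  | succ k ih =>
    have hX : (RatFunc.X : RatFunc ℤ) ≠ 0 := by
      rw [← RatFunc.algebraMap_X]
      exact RatFunc.algebraMap_ne_zero X_ne_zero
    have h1 := ih (j + 1)
    have h2 := congrArg (algebraMap ℤ[X] (RatFunc ℤ))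
      (X_pow_mul_gaussBinom_succ_right (k + 1 + j) k)
    simp only [map_mul, map_sub, map_pow, map_one, RatFunc.algebraMap_X] at h2
    have hs (i : ℕ) : qShiftedFactorial (RatFunc.X : RatFunc ℤ) RatFunc.X (i + 1) =
        qShiftedFactorial RatFunc.X RatFunc.X i * (1 - RatFunc.X ^ (i + 1)) := by
      simp [qShiftedFactorial, Finset.prod_range_succ, pow_succ']
    rw [hs] at h1
    rw [hs]
    rw [show k + (j + 1) = k + 1 + j by ring] at h1
    rw [← h1]
    refine mul_left_cancel₀ (pow_ne_zero k hX) ?_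
    linear_combination qShiftedFactorial (RatFunc.X : RatFunc ℤ) RatFunc.X k *
      qShiftedFactorial (RatFunc.X : RatFunc ℤ) RatFunc.X j * h2

theorem qShiftedFactorial_X_ne_zero (n : ℕ) :
    qShiftedFactorial (RatFunc.X : RatFunc ℤ) RatFunc.X n ≠ 0 := by
  refine Finset.prod_ne_zero_iff.2 fun i _ h => ?_
  have h1 : algebraMap ℤ[X] (RatFunc ℤ) (1 - X ^ (i + 1)) = algebraMap ℤ[X] (RatFunc ℤ) 0 := by
    simpa [pow_succ'] using h
  have h2 := congrArg (eval 0) (RatFunc.algebraMap_injective ℤ h1)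
  simp at h2

theorem algebraMap_gaussBinom_two_mul (k : ℕ) :
    algebraMap ℤ[X] (RatFunc ℤ) (gaussBinom (2 * k) k) = qBinomial RatFunc.X (2 * k) k := by
  rw [qBinomial, if_pos (by omega), eq_div_iff
    (mul_ne_zero (qShiftedFactorial_X_ne_zero _) (qShiftedFactorial_X_ne_zero _))]
  rw [show 2 * k - k = k by omega, show 2 * k = k + k by ring]
  exact algebraMap_gaussBinom_mul k k

/-! ### Expansion in shifted central coefficients -/

/-- The Gaussian binomial coefficient `[2n choose n + d]`. -/
noncomputable def shiftedCentralGauss (n d : ℕ) : ℤ[X] := gaussBinom (2 * n) (n + d)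

theorem shiftedCentralGauss_eq_zero_of_lt {n d : ℕ} (h : n < d) : shiftedCentralGauss n d = 0 :=
  gaussBinom_eq_zero_of_lt (by omega)

theorem shiftedCentralGauss_self (n : ℕ) : shiftedCentralGauss n n = 1 := by
  rw [shiftedCentralGauss, ← two_mul, gaussBinom_self]

theorem shiftedCentralGauss_succ_right (n d : ℕ) :
    X ^ d * (1 - X ^ (n + d + 1)) * shiftedCentralGauss n (d + 1) =
      (X ^ d - X ^ n) * shiftedCentralGauss n d := by
  refine mul_left_cancel₀ (pow_ne_zero n (X_ne_zero (R := ℤ))) ?_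
  unfold shiftedCentralGauss
  linear_combination X_pow_mul_gaussBinom_succ_right (2 * n) (n + d)

theorem shiftedCentralGauss_succ_succ (n d : ℕ) :
    X ^ d * shiftedCentralGauss (n + 1) (d + 1) =
      X ^ d * (1 + X ^ (2 * n + 1)) * shiftedCentralGauss n (d + 1) +
        X ^ n * shiftedCentralGauss n d + X ^ (n + 2 * d + 2) * shiftedCentralGauss n (d + 2) := by
  refine mul_left_cancel₀ (pow_ne_zero n (X_ne_zero (R := ℤ))) ?_
  unfold shiftedCentralGauss
  have h1 := gaussBinom_succ_succ (2 * n + 1) (n + d + 1)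
  have h2 := X_pow_mul_gaussBinom_succ_succ (2 * n) (n + d)
  have h3 := X_pow_mul_gaussBinom_succ_succ (2 * n) (n + d + 1)
  rw [show 2 * (n + 1) = 2 * n + 1 + 1 by ring, show n + 1 + (d + 1) = n + d + 1 + 1 by ring,
    ← add_assoc, ← add_assoc]
  linear_combination X ^ (n + d) * h1 + h2 + X ^ (n + d + 1) * h3

/-- Induction on `n`: the increment of the `i`th block is a difference of consecutive values of `X ^
(6 * i ^ 2 + n) * [2n choose n + 3i]`. It telescopes to the new summand at `i = 0`; the end `i = M`
vanishes as `n < 3 * M`. -/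
theorem sum_X_pow_mul_central_gaussBinom {n M : ℕ} (h : n ≤ 3 * M) :
    ∑ k ∈ Finset.range n, X ^ k * gaussBinom (2 * k) k =
      ∑ i ∈ Finset.range M, (X ^ (6 * i ^ 2 + 3 * i) * shiftedCentralGauss n (3 * i + 1) -
        X ^ (6 * i ^ 2 + 9 * i + 3) * shiftedCentralGauss n (3 * i + 2)) := by
  induction n with
  | zero =>
    simp [shiftedCentralGauss_eq_zero_of_lt]
  | succ n ih =>
    rw [Finset.sum_range_succ, ih (by omega), eq_comm, ← sub_eq_iff_eq_add', ← Finset.sum_sub_distrib]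
    have hM : (X : ℤ[X]) ^ (6 * M ^ 2 + n) * shiftedCentralGauss n (3 * M) = 0 := by
      rw [shiftedCentralGauss_eq_zero_of_lt (by omega), mul_zero]
    have h0 : (X : ℤ[X]) ^ (6 * 0 ^ 2 + n) * shiftedCentralGauss n (3 * 0) =
        X ^ n * gaussBinom (2 * n) n := by simp [shiftedCentralGauss]
    rw [← h0, ← sub_zero (X ^ (6 * 0 ^ 2 + n) * _), ← hM,
      ← Finset.sum_range_sub' (fun i => X ^ (6 * i ^ 2 + n) * shiftedCentralGauss n (3 * i))]
    refine Finset.sum_congr rfl fun i _ => ?_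
    have h1 := shiftedCentralGauss_succ_succ n (3 * i)
    have h2 := shiftedCentralGauss_succ_succ n (3 * i + 1)
    have h3 := shiftedCentralGauss_succ_right n (3 * i + 1)
    rw [show 3 * (i + 1) = 3 * i + 1 + 2 by ring]
    linear_combination X ^ (6 * i ^ 2) * h1 - X ^ (6 * i ^ 2 + 6 * i + 2) * h2
      + X ^ (6 * i ^ 2 + 3 * i + n + 1) * h3

/-! ### Finite sums of quotients in a general `r` -/

theorem Finset.sum_range_eq_zero_of_reflect {K : Type*} [Field K] [CharZero K] (n : ℕ) (u : ℕ → K)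
    (h : ∀ k < n, u (n - 1 - k) = -u k) : ∑ k ∈ Finset.range n, u k = 0 := by
  have h1 := Finset.sum_range_reflect u n
  rw [Finset.sum_congr rfl fun k hk => h k (Finset.mem_range.1 hk), Finset.sum_neg_distrib] at h1
  exact self_eq_neg.1 h1.symm

/-- Paired exponents add up to `2 * n`, and `1 / (1 - x) + 1 / (1 - x⁻¹) = 1`. -/
theorem sum_one_div_reflect {K : Type*} [Field K] {r : K} (n a b : ℕ) (hab : 2 * a + b = n + 1)
    (hrn : r ^ (2 * n) = 1) (h : ∀ k : ℕ, 1 ≤ k → k < n → r ^ (2 * k) ≠ 1) (ha : 1 ≤ a) :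
    2 * ∑ k ∈ Finset.range b, 1 / (1 - r ^ (2 * (a + k))) = b := by
  nth_rewrite 1 [two_mul, ← Finset.sum_range_reflect, ← Finset.sum_add_distrib]
  rw [Finset.sum_congr rfl (g := fun _ => 1)]
  · simp
  intro k hk
  rw [Finset.mem_range] at hk
  have h1 := h (a + k) (by omega) (by omega)
  have h2 := h (a + (b - 1 - k)) (by omega) (by omega)
  have h3 : r ^ (2 * (a + k)) * r ^ (2 * (a + (b - 1 - k))) = 1 := by
    rw [← pow_add, ← hrn]; congr 1; omega
  generalize r ^ (2 * (a + k)) = x at *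
  generalize r ^ (2 * (a + (b - 1 - k))) = y at *
  have h4 : 1 - x ≠ 0 := sub_ne_zero.2 h1.symm
  have h5 : 1 - y ≠ 0 := sub_ne_zero.2 h2.symm
  field_simp
  linear_combination -h3

/-- The summand `(-1)^(k-1) r^(k(k+1)-2kM) / (1-r^(2k))`. -/
noncomputable def gaussianQuotient {K : Type*} [Field K] (r : K) (M k : ℤ) : K :=
  -(-1) ^ k * r ^ (k * (k + 1) - 2 * k * M) / (1 - r ^ (2 * k))

section GaussianQuotient

variable {K : Type*} [Field K] [CharZero K] {r : K}

/-- Termwise the difference loses its denominator, and what is left is odd under `k ↦ 2 * m - 1 -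
k`. -/
theorem sum_gaussianQuotient_add_one (hr : r ≠ 0) (m : ℕ)
    (h : ∀ k : ℕ, 1 ≤ k → k ≤ 2 * m → r ^ (2 * k) ≠ 1) :
    ∑ k ∈ Finset.range (2 * m), gaussianQuotient r (m + 1) (k + 1) =
      ∑ k ∈ Finset.range (2 * m), gaussianQuotient r m (k + 1) := by
  rw [← sub_eq_zero, ← Finset.sum_sub_distrib]
  have key (k : ℕ) (hk : k < 2 * m) :
      gaussianQuotient r (m + 1) (k + 1) - gaussianQuotient r m (k + 1) =
        (-1) ^ k * r ^ (((k : ℤ) + 1) * (k - 2 * m)) := by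
    have h1 : 1 - r ^ (2 * ((k : ℤ) + 1)) ≠ 0 := by
      rw [sub_ne_zero]
      exact_mod_cast (h (k + 1) (by omega) (by omega)).symm
    have h2 : r ^ (((k : ℤ) + 1) * (k + 1 + 1) - 2 * (k + 1) * m) =
        r ^ (((k : ℤ) + 1) * (k - 2 * m)) * r ^ (2 * ((k : ℤ) + 1)) := by
      rw [← zpow_add₀ hr]; ring_nf
    have h3 : r ^ (((k : ℤ) + 1) * (k + 1 + 1) - 2 * (k + 1) * (m + 1)) =
        r ^ (((k : ℤ) + 1) * (k - 2 * m)) := by ring_nf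
    have h4 : (-1 : K) ^ ((k : ℤ) + 1) = -(-1) ^ k := by
      rw [zpow_add_one₀ (by norm_num), zpow_natCast]; ring
    rw [gaussianQuotient, gaussianQuotient, h2, h3, h4]
    field_simp
  rw [Finset.sum_congr rfl fun k hk => key k (Finset.mem_range.1 hk)]
  refine Finset.sum_range_eq_zero_of_reflect _ _ fun k hk => ?_
  obtain ⟨l, hl⟩ : ∃ l, 2 * m = k + 1 + l := ⟨2 * m - (k + 1), by omega⟩
  have hl' : 2 * (m : ℤ) = k + 1 + l := by exact_mod_cast hl
  have hs : (-1 : K) ^ l = -(-1) ^ k := by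
    have : (-1 : K) ^ k * (-1) ^ l = -1 := by
      rw [← pow_add]; exact Odd.neg_one_pow ⟨m - 1, by omega⟩
    have h1 : (-1 : K) ^ k * (-1) ^ k = 1 := by rw [← mul_pow]; simp
    linear_combination (-1 : K) ^ k * this - (-1 : K) ^ l * h1
  rw [show 2 * m - 1 - k = l by omega, hl', hs]
  ring_nf

theorem sum_gaussianQuotient_odd (hr : r ≠ 0) (m : ℕ)
    (h : ∀ k : ℕ, 1 ≤ k → k ≤ 2 * m → r ^ (2 * k) ≠ 1) :
    ∑ k ∈ Finset.range (2 * m + 1), gaussianQuotient r (m + 1) (k + 1) =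
      ∑ k ∈ Finset.range (2 * m), gaussianQuotient r m (k + 1) + 1 / (1 - r ^ (2 * (2 * m + 1))) := by
  rw [Finset.sum_range_succ, sum_gaussianQuotient_add_one hr m h, gaussianQuotient]
  congr 2
  · have : ((2 * m : ℕ) : ℤ) + 1 = ((2 * m + 1 : ℕ) : ℤ) := by push_cast; ring
    rw [this, zpow_natCast, Odd.neg_one_pow ⟨m, rfl⟩]
    push_cast
    ring_nf
    simp
  · norm_cast

/-- Passing from `m` to `m + 1` appends two fractions and removes the first, which slides the window
from `(m, 2m]` to `(m + 1, 2m + 2]`. -/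
theorem sum_gaussianQuotient_even (hr : r ≠ 0) (m : ℕ)
    (h : ∀ k : ℕ, 1 ≤ k → k ≤ 2 * m → r ^ (2 * k) ≠ 1) :
    ∑ k ∈ Finset.range (2 * m), gaussianQuotient r m (k + 1) =
      ∑ k ∈ Finset.range m, 1 / (1 - r ^ (2 * (m + 1 + k))) := by
  induction m with
  | zero => simp
  | succ m ih =>
    have h' : ∀ k : ℕ, 1 ≤ k → k ≤ 2 * m → r ^ (2 * k) ≠ 1 := fun k h1 h2 => h k h1 (by omega)
    have hodd := sum_gaussianQuotient_odd hr m h'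
    rw [ih h'] at hodd
    push_cast
    rw [show 2 * (m + 1) = 2 * m + 1 + 1 by ring, Finset.sum_range_succ, hodd]
    -- With `y = r ^ (2 * (m + 1))` this is `-y / (1 - y ^ 2) = 1 / (1 - y ^ 2) - 1 / (1 - y)`.
    have h1 : gaussianQuotient r (m + 1) ((2 * m + 1 : ℕ) + 1) =
        1 / (1 - r ^ (2 * (2 * m + 2))) - 1 / (1 - r ^ (2 * (m + 1))) := by
      have e1 : (((2 * m + 1 : ℕ) : ℤ) + 1) = ((2 * m + 2 : ℕ) : ℤ) := by push_cast; ring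
      have e2 : ((2 * m + 2 : ℕ) : ℤ) * ((2 * m + 2 : ℕ) + 1) - 2 * (2 * m + 2 : ℕ) * (m + 1) =
          ((2 * (m + 1) : ℕ) : ℤ) := by push_cast; ring
      have h2 := h (m + 1) (by omega) (by omega)
      have h3 := h (2 * m + 2) (by omega) (by omega)
      have e3 : r ^ (2 * (2 * m + 2)) = (r ^ (2 * (m + 1))) ^ 2 := by rw [← pow_mul]; ring_nf
      rw [gaussianQuotient, e1, e2, zpow_natCast, zpow_natCast, Even.neg_one_pow ⟨m + 1, by ring⟩]
      have e4 : r ^ (2 * ((2 * m + 2 : ℕ) : ℤ)) = r ^ (2 * (2 * m + 2)) := by norm_cast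
      rw [e4]
      rw [e3] at h3 ⊢
      generalize r ^ (2 * (m + 1)) = y at *
      have h4 : 1 - y ≠ 0 := sub_ne_zero.2 h2.symm
      have h5 : 1 - y ^ 2 ≠ 0 := sub_ne_zero.2 h3.symm
      field_simp
      ring
    have h2 := Finset.sum_range_succ (fun k => 1 / (1 - r ^ (2 * (m + 1 + k)))) m
    rw [Finset.sum_range_succ'] at h2
    rw [h1, Finset.sum_range_succ]
    have e1 (k : ℕ) : m + 1 + (k + 1) = m + 2 + k := by ring
    simp only [e1, add_zero] at h2
    rw [show 2 * m + 1 = m + 1 + m by ring, show 2 * m + 2 = m + 2 + m by ring,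
      show m + 1 + 1 = m + 2 by ring]
    linear_combination -h2

end GaussianQuotient

/-! ### Evaluation of the theta block when `p ^ n = -1` -/

/-- The summand `(-1)^i p^(3i(i+1)) / (1 - p^(6i+2))`. -/
noncomputable def thetaQuotient {K : Type*} [Field K] (p : K) (i : ℤ) : K :=
  (-1) ^ i * p ^ (3 * i * (i + 1)) / (1 - p ^ (6 * i + 2))

section ThetaQuotient

variable {K : Type*} [Field K] {p : K}

theorem pow_six_mul_ne_one {n : ℕ} (hn : Nat.Coprime 3 n) (hp : IsPrimitiveRoot (p ^ 2) n) (k : ℕ)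
    (h1 : 1 ≤ k) (h2 : k < n) : (p ^ 3) ^ (2 * k) ≠ 1 := by
  intro h
  have h3 : (p ^ 2) ^ (3 * k) = 1 := by rw [← h, ← pow_mul, ← pow_mul]; ring_nf
  have h4 := (hn.symm.dvd_of_dvd_mul_left (hp.dvd_of_pow_eq_one _ h3))
  exact absurd (Nat.le_of_dvd h1 h4) (by omega)

theorem zpow_mul_of_pow_eq_neg_one {n : ℕ} (hpn : p ^ n = -1) (k : ℤ) :
    p ^ ((n : ℤ) * k) = (-1) ^ k := by
  rw [zpow_mul, zpow_natCast, hpn]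

theorem sum_thetaQuotient_pairs (p : K) (m : ℕ) :
    ∑ i ∈ Finset.range m, (thetaQuotient p i + thetaQuotient p (-1 - i)) =
      ∑ k ∈ Finset.range (2 * m), thetaQuotient p (m - (k + 1)) := by
  rw [two_mul, Finset.sum_range_add, Finset.sum_add_distrib, ← Finset.sum_range_reflect]
  congr 1
  · refine Finset.sum_congr rfl fun k hk => ?_
    rw [Finset.mem_range] at hk
    congr 1
    omega
  · refine Finset.sum_congr rfl fun k hk => ?_
    congr 1
    push_cast
    ring

/-- The shift `i ↦ i - m` preserves the denominator, as `p ^ (6 * m) = 1`, and flips the sign. -/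
theorem sum_thetaQuotient_three_mul (hp : p ≠ 0) (m : ℕ) (hpn : p ^ (3 * m) = -1) :
    ∑ i ∈ Finset.range m, (thetaQuotient p i + thetaQuotient p (-1 - i)) = 0 := by
  rw [Finset.sum_add_distrib, ← Finset.sum_range_reflect (fun i : ℕ => thetaQuotient p (-1 - i)),
    ← Finset.sum_add_distrib]
  refine Finset.sum_eq_zero fun i hi => ?_
  rw [Finset.mem_range] at hi
  rw [show (-1 - ((m - 1 - i : ℕ) : ℤ)) = i - m by omega]
  have hz := zpow_mul_of_pow_eq_neg_one hpn
  have h1 : p ^ (6 * ((i : ℤ) - m) + 2) = p ^ (6 * (i : ℤ) + 2) := by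
    rw [show 6 * ((i : ℤ) - m) + 2 = (6 * i + 2) + (3 * m : ℕ) * (-2) by push_cast; ring,
      zpow_add₀ hp, hz]
    norm_num
  have h2 : p ^ (3 * ((i : ℤ) - m) * (i - m + 1)) =
      p ^ (3 * (i : ℤ) * (i + 1)) * (-1) ^ ((m : ℤ) - 2 * i - 1) := by
    rw [← hz, ← zpow_add₀ hp]
    push_cast
    ring_nf
  have h3 : (-1 : K) ^ ((i : ℤ) - m) * (-1) ^ ((m : ℤ) - 2 * i - 1) = -(-1) ^ (i : ℤ) := by
    rw [← zpow_add₀ (by norm_num), show (i : ℤ) - m + (m - 2 * i - 1) = i + -1 + -2 * i by ring,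
      zpow_add₀ (by norm_num), zpow_add₀ (by norm_num), zpow_mul]
    norm_num
  rw [thetaQuotient, thetaQuotient, h1, h2]
  linear_combination h3 * p ^ (3 * (i : ℤ) * (i + 1)) / (1 - p ^ (6 * (i : ℤ) + 2))

theorem neg_one_zpow_sub (a b : ℤ) : (-1 : K) ^ (a - b) = (-1) ^ a * (-1) ^ b := by
  rw [zpow_sub₀ (by norm_num), div_eq_mul_inv, ← inv_zpow]
  norm_num

/-- Since `6 * m + 2 = 2 * n`, the index `i = m - k` has denominator `1 - r ^ (-2 * k)` with `r = p
^ 3`. -/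
theorem sum_thetaQuotient_three_mul_add_one [CharZero K] (hp : p ≠ 0) (m : ℕ) (hpn : p ^ (3 * m + 1) = -1)
    (hprim : IsPrimitiveRoot (p ^ 2) (3 * m + 1)) :
    2 * ∑ i ∈ Finset.range m, (thetaQuotient p i + thetaQuotient p (-1 - i)) =
      m * p ^ (2 * (3 * m ^ 2 + 2 * m)) := by
  have hz := zpow_mul_of_pow_eq_neg_one hpn
  have hne := pow_six_mul_ne_one (by simp) hprim
  have hr : p ^ 3 ≠ 0 := pow_ne_zero _ hp
  have h1 (k : ℕ) (hk : k < 2 * m) : thetaQuotient p (m - (k + 1)) =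
      p ^ (2 * (3 * m ^ 2 + 2 * m)) * gaussianQuotient (p ^ 3) m (k + 1) := by
    have hk1 := hne (k + 1) (by omega) (by omega)
    have e0 : (p ^ 3) ^ (2 * ((k : ℤ) + 1)) = (p ^ 3) ^ (2 * (k + 1)) := by norm_cast
    have e1 : p ^ (6 * ((m : ℤ) - (k + 1)) + 2) = ((p ^ 3) ^ (2 * (k + 1)))⁻¹ := by
      rw [show 6 * ((m : ℤ) - (k + 1)) + 2 =
        -((3 : ℕ) * (2 * (k + 1) : ℕ)) + (3 * m + 1 : ℕ) * 2 by push_cast; ring,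
        zpow_add₀ hp, hz, zpow_neg, zpow_mul, zpow_natCast, zpow_natCast]
      norm_num
    have e2 : p ^ (3 * ((m : ℤ) - (k + 1)) * (m - (k + 1) + 1)) * (p ^ 3) ^ (2 * (k + 1)) =
        p ^ (2 * (3 * m ^ 2 + 2 * m)) *
          (p ^ 3) ^ (((k : ℤ) + 1) * (k + 1 + 1) - 2 * (k + 1) * m) * (-1) ^ (m : ℤ) := by
      rw [← zpow_natCast p 3, ← zpow_natCast, ← zpow_natCast p (2 * _), ← zpow_mul, ← zpow_mul,
        ← zpow_add₀ hp, ← zpow_add₀ hp,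
        show (-1 : K) ^ (m : ℤ) = p ^ (((3 * m + 1 : ℕ) : ℤ) * -m) by
          rw [hz, zpow_neg, ← inv_zpow]; norm_num,
        ← zpow_add₀ hp]
      push_cast
      ring_nf
    rw [thetaQuotient, gaussianQuotient, e0, e1, neg_one_zpow_sub]
    have hx : (p ^ 3) ^ (2 * (k + 1)) ≠ 0 := pow_ne_zero _ hr
    have hm : (-1 : K) ^ (m : ℤ) * (-1) ^ (m : ℤ) = 1 := by
      rw [← mul_zpow]; norm_num
    generalize (p ^ 3) ^ (2 * (k + 1)) = x at *
    have hx1 : 1 - x ≠ 0 := sub_ne_zero.2 hk1.symm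
    have hx2 : x - 1 ≠ 0 := sub_ne_zero.2 hk1
    have e3 : 1 - x⁻¹ = -(1 - x) / x := by field_simp; ring
    rw [e3, div_div_eq_mul_div, div_neg, mul_assoc, e2, ← mul_div_assoc, ← neg_div]
    congr 1
    linear_combination -(-1 : K) ^ ((k : ℤ) + 1) * p ^ (2 * (3 * m ^ 2 + 2 * m)) *
          (p ^ 3) ^ (((k : ℤ) + 1) * (k + 1 + 1) - 2 * (k + 1) * m) * hm
  rw [sum_thetaQuotient_pairs, Finset.sum_congr rfl fun k hk => h1 k (Finset.mem_range.1 hk),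
    ← Finset.mul_sum, sum_gaussianQuotient_even hr m fun k h1 h2 => hne k h1 (by omega)]
  -- The window `m + 1, …, 2 * m` is stable under `k ↦ n - k`.
  have h2 := sum_one_div_reflect (r := p ^ 3) (3 * m + 1) (m + 1) m (by ring) (by
    rw [← pow_mul, show 3 * (2 * (3 * m + 1)) = (3 * m + 1) * 6 by ring, pow_mul, hpn]; norm_num)
    hne (by omega)
  linear_combination p ^ (2 * (3 * m ^ 2 + 2 * m)) * h2

/-- The index `m` has no partner: `-1 - m` would correspond to `d = n`, whose coefficient is 1. -/
theorem sum_thetaQuotient_three_mul_add_two [CharZero K] (hp : p ≠ 0) (m : ℕ) (hpn : p ^ (3 * m + 2) = -1)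
    (hprim : IsPrimitiveRoot (p ^ 2) (3 * m + 2)) :
    2 * (∑ i ∈ Finset.range m, (thetaQuotient p i + thetaQuotient p (-1 - i)) +
      thetaQuotient p m) = -((m + 1) * p ^ (2 * (3 * m ^ 2 + 4 * m + 1))) := by
  have hz := zpow_mul_of_pow_eq_neg_one hpn
  have hne := pow_six_mul_ne_one (by rw [Nat.coprime_mul_left_add_right]; norm_num) hprim
  have hr : p ^ 3 ≠ 0 := pow_ne_zero _ hp
  have h0 : ∑ i ∈ Finset.range m, (thetaQuotient p i + thetaQuotient p (-1 - i)) +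
      thetaQuotient p m =
        ∑ k ∈ Finset.range (2 * m + 1), thetaQuotient p ((k + 1) - (m + 1)) := by
    rw [sum_thetaQuotient_pairs, ← Finset.sum_range_reflect, Finset.sum_range_succ]
    congr 1
    · refine Finset.sum_congr rfl fun k hk => ?_
      rw [Finset.mem_range] at hk
      congr 1
      omega
    · congr 1; push_cast; ring
  have h1 (k : ℕ) (hk : k < 2 * m + 1) : thetaQuotient p ((k + 1) - (m + 1)) =
      -p ^ (2 * (3 * m ^ 2 + 4 * m + 1)) * gaussianQuotient (p ^ 3) (m + 1) (k + 1) := by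
    have e0 : p ^ (6 * ((k : ℤ) + 1 - (m + 1)) + 2) = (p ^ 3) ^ (2 * ((k : ℤ) + 1)) := by
      rw [show 6 * ((k : ℤ) + 1 - (m + 1)) + 2 =
        (3 : ℕ) * (2 * (k + 1)) + (3 * m + 2 : ℕ) * (-2) by push_cast; ring,
        zpow_add₀ hp, hz, zpow_mul, zpow_natCast]
      norm_num
    have e2 : p ^ (3 * ((k : ℤ) + 1 - (m + 1)) * (k + 1 - (m + 1) + 1)) =
        p ^ (2 * (3 * m ^ 2 + 4 * m + 1)) *
          (p ^ 3) ^ (((k : ℤ) + 1) * (k + 1 + 1) - 2 * (k + 1) * (m + 1)) *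
            (-1) ^ ((m : ℤ) + 1) := by
      rw [show (-1 : K) ^ ((m : ℤ) + 1) = p ^ (((3 * m + 2 : ℕ) : ℤ) * -(m + 1)) by
          rw [hz, zpow_neg, ← inv_zpow]; norm_num,
        ← zpow_natCast p 3, ← zpow_natCast p (2 * _), ← zpow_mul, ← zpow_add₀ hp, ← zpow_add₀ hp]
      push_cast
      ring_nf
    rw [thetaQuotient, gaussianQuotient, e0, e2, neg_one_zpow_sub]
    have hm : (-1 : K) ^ ((m : ℤ) + 1) * (-1) ^ ((m : ℤ) + 1) = 1 := by
      rw [← mul_zpow]; norm_num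
    rw [← mul_div_assoc]
    congr 1
    linear_combination (-1 : K) ^ ((k : ℤ) + 1) * p ^ (2 * (3 * m ^ 2 + 4 * m + 1)) *
          (p ^ 3) ^ (((k : ℤ) + 1) * (k + 1 + 1) - 2 * (k + 1) * (m + 1)) * hm
  rw [h0, Finset.sum_congr rfl fun k hk => h1 k (Finset.mem_range.1 hk),
    ← Finset.mul_sum, sum_gaussianQuotient_odd hr m fun k h1 h2 => hne k h1 (by omega),
    sum_gaussianQuotient_even hr m fun k h1 h2 => hne k h1 (by omega)]
  have h2 := sum_one_div_reflect (r := p ^ 3) (3 * m + 2) (m + 1) (m + 1) (by ring) (by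
    rw [← pow_mul, show 3 * (2 * (3 * m + 2)) = (3 * m + 2) * 6 by ring, pow_mul, hpn]; norm_num)
    hne (by omega)
  rw [Finset.sum_range_succ, show m + 1 + m = 2 * m + 1 by ring] at h2
  push_cast at h2
  linear_combination -p ^ (2 * (3 * m ^ 2 + 4 * m + 1)) * h2

end ThetaQuotient

/-! ### Values and derivatives at primitive roots of unity -/

section RootOfUnity

/-- For even `n` either square root works, by primitivity; for odd `n` one chooses the sign. -/
theorem exists_sq_eq_and_pow_eq_neg_one {n : ℕ} (hn : 0 < n) {z : ℂ} (hz : IsPrimitiveRoot z n) :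
    ∃ p : ℂ, p ^ 2 = z ∧ p ^ n = -1 := by
  obtain ⟨p, hp⟩ := IsAlgClosed.exists_pow_nat_eq z (n := 2) (by norm_num)
  have h1 : p ^ n = 1 ∨ p ^ n = -1 := by
    rw [← sq_eq_one_iff, ← pow_mul, mul_comm, pow_mul, hp, hz.pow_eq_one]
  rcases h1 with h1 | h1
  · rcases Nat.even_or_odd' n with ⟨c, rfl | rfl⟩
    · rw [pow_mul, hp] at h1
      have := Nat.le_of_dvd (by omega) (hz.dvd_of_pow_eq_one _ h1)
      omega
    · exact ⟨-p, by rw [neg_sq, hp], by rw [Odd.neg_pow ⟨c, rfl⟩, h1]⟩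
  · exact ⟨p, hp, h1⟩

/-- The derivative of an integer polynomial at `z`. -/
noncomputable def derivAt (z : ℂ) : ℤ[X] →+ ℂ :=
  (aeval z : ℤ[X] →ₐ[ℤ] ℂ).toAddMonoidHom.comp derivative.toAddMonoidHom

theorem derivAt_mul (z : ℂ) (P Q : ℤ[X]) :
    derivAt z (P * Q) = derivAt z P * aeval z Q + aeval z P * derivAt z Q := by
  simp [derivAt]

theorem derivAt_X_pow {z : ℂ} (hz : z ≠ 0) (e : ℕ) : derivAt z (X ^ e) = e * z ^ e / z := by
  rcases e with _ | e
  · simp [derivAt]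
  · simp [derivAt]
    field_simp
    ring

theorem derivAt_one (z : ℂ) : derivAt z 1 = 0 := by simp [derivAt]

/-- Over `ℂ` the square is a product of coprime `(X - z) ^ 2`; divisibility descends to `ℤ` because
the divisor is monic. -/
theorem sq_cyclotomic_dvd {n : ℕ} (hn : 0 < n) {P : ℤ[X]}
    (h : ∀ z : ℂ, IsPrimitiveRoot z n → aeval z P = 0 ∧ derivAt z P = 0) :
    cyclotomic n ℤ ^ 2 ∣ P := by
  rw [← map_dvd_map (Int.castRingHom ℂ) Int.cast_injective ((cyclotomic.monic n ℤ).pow 2),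
    Polynomial.map_pow, map_cyclotomic,
    cyclotomic_eq_prod_X_sub_primitiveRoots (Complex.isPrimitiveRoot_exp n hn.ne'),
    ← Finset.prod_pow]
  refine Finset.prod_dvd_of_coprime (fun a _ b _ hab =>
    (isCoprime_X_sub_C_of_isUnit_sub (sub_ne_zero.2 hab).isUnit).pow) fun z hz => ?_
  obtain ⟨h1, h2⟩ := h z ((mem_primitiveRoots hn).1 hz)
  have e1 : eval z (P.map (Int.castRingHom ℂ)) = 0 := by
    rw [← h1, aeval_def, eval_map]; rfl
  have e2 : eval z (derivative (P.map (Int.castRingHom ℂ))) = 0 := by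
    rw [← h2, derivative_map, eval_map]; rfl
  obtain ⟨Q, hQ⟩ := dvd_iff_isRoot.2 e1
  rw [hQ] at e2 ⊢
  have e3 : eval z Q = 0 := by simpa using e2
  rw [pow_two]
  exact mul_dvd_mul_left _ (dvd_iff_isRoot.2 e3)

variable {n : ℕ} {p : ℂ}

theorem aeval_shiftedCentralGauss {z : ℂ} (hz : IsPrimitiveRoot z n) {d : ℕ} (h1 : 1 ≤ d)
    (h2 : d < n) : aeval z (shiftedCentralGauss n d) = 0 := by
  induction d with
  | zero => omega
  | succ d ih =>
    have h := congrArg (aeval z) (shiftedCentralGauss_succ_right n d)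
    simp only [map_mul, map_sub, map_pow, aeval_X, map_one] at h
    have h3 : (z ^ d - z ^ n) * aeval z (shiftedCentralGauss n d) = 0 := by
      rcases d.eq_zero_or_pos with rfl | hd
      · simp [hz.pow_eq_one]
      · rw [ih hd (by omega), mul_zero]
    rw [h3, add_assoc, pow_add, hz.pow_eq_one, one_mul] at h
    have h4 : 1 - z ^ (d + 1) ≠ 0 :=
      sub_ne_zero.2 (hz.pow_ne_one_of_pos_of_lt (by omega) h2).symm
    have h5 : z ^ d ≠ 0 := pow_ne_zero _ (hz.ne_zero (by omega))
    simpa [h4, h5] using h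

/-- Differentiating the ratio recurrence leaves only derivatives, as the values vanish. Induction
runs down from `d = n - 1`, where the neighbour `[2n choose 2n] = 1` and the factor `1 - X ^ (2 *
n)` yield `2 * n`. -/
theorem derivAt_shiftedCentralGauss (hp : p ≠ 0) (hpn : p ^ n = -1)
    (hprim : IsPrimitiveRoot (p ^ 2) n) {d : ℕ} (h1 : 1 ≤ d) (h2 : d < n) :
    derivAt (p ^ 2) (shiftedCentralGauss n d) * (1 - p ^ (2 * d)) =
      2 * n * p ^ (-2 - (d : ℤ) * (d - 1)) * (-1) ^ d := by
  obtain ⟨j, hj⟩ : ∃ j, d + j + 1 = n := ⟨n - d - 1, by omega⟩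
  have hz1 : (p ^ 2) ^ n = 1 := hprim.pow_eq_one
  have hz0 : p ^ 2 ≠ 0 := pow_ne_zero _ hp
  have hrel (d : ℕ) := congrArg (derivAt (p ^ 2)) (shiftedCentralGauss_succ_right n d)
  simp only [derivAt_mul, map_sub, map_mul, map_pow, map_one, aeval_X, derivAt_X_pow hz0,
    derivAt_one, zero_sub, add_assoc, pow_add (p ^ 2) n, hz1, one_mul, mul_one] at hrel
  induction j generalizing d with
  | zero =>
    obtain rfl : n = d + 1 := by omega
    have h := hrel d
    rw [shiftedCentralGauss_self, aeval_shiftedCentralGauss hprim h1 h2, map_one, derivAt_one,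
      hz1] at h
    have e2 : p ^ (-2 - (d : ℤ) * (d - 1)) * (-1) ^ d * p ^ 2 = p ^ (2 * d) := by
      have : (-1 : ℂ) ^ d = p ^ (((d + 1 : ℕ) : ℤ) * d) := by
        rw [zpow_mul_of_pow_eq_neg_one hpn, zpow_natCast]
      rw [this, ← zpow_natCast, ← zpow_natCast p (2 * d), ← zpow_add₀ hp, ← zpow_add₀ hp]
      push_cast
      ring_nf
    have e3 : p ^ (-2 - (d : ℤ) * (d - 1)) * (-1) ^ d = p ^ (2 * d) / p ^ 2 := by
      rw [← e2]
      field_simp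
    rw [mul_assoc, e3]
    push_cast at h ⊢
    linear_combination h
  | succ j ih =>
    have h := hrel d
    rw [aeval_shiftedCentralGauss hprim h1 h2,
      aeval_shiftedCentralGauss hprim (Nat.le_add_left 1 d) (by omega)] at h
    have h3 := ih (d := d + 1) (by omega) (by omega) (by omega)
    have e : p ^ (-2 - ((d + 1 : ℕ) : ℤ) * ((d + 1 : ℕ) - 1)) * p ^ (2 * d) =
        p ^ (-2 - (d : ℤ) * (d - 1)) := by
      rw [← zpow_natCast, ← zpow_add₀ hp]
      push_cast
      ring_nf
    rw [← e]
    linear_combination h - p ^ (2 * d) * h3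

theorem derivAt_X_pow_mul_shiftedCentralGauss_one (hp : p ≠ 0) (hpn : p ^ n = -1)
    (hprim : IsPrimitiveRoot (p ^ 2) n) {i : ℕ} (h : 3 * i + 1 < n) :
    derivAt (p ^ 2) (X ^ (6 * i ^ 2 + 3 * i) * shiftedCentralGauss n (3 * i + 1)) =
      -(2 * n / p ^ 2) * thetaQuotient p i := by
  have hg := derivAt_shiftedCentralGauss hp hpn hprim (Nat.le_add_left 1 (3 * i)) h
  have h1 : 1 - p ^ (2 * (3 * i + 1)) ≠ 0 := by
    rw [pow_mul]
    exact sub_ne_zero.2 (hprim.pow_ne_one_of_pos_of_lt (by omega) h).symm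
  have e1 : p ^ (6 * (i : ℤ) + 2) = p ^ (2 * (3 * i + 1)) := by
    rw [← zpow_natCast]; push_cast; ring_nf
  have e2 : (p ^ 2) ^ (6 * i ^ 2 + 3 * i) *
      p ^ (-2 - ((3 * i + 1 : ℕ) : ℤ) * ((3 * i + 1 : ℕ) - 1)) =
      p ^ (3 * (i : ℤ) * (i + 1)) / p ^ 2 := by
    rw [eq_div_iff (pow_ne_zero _ hp), ← pow_mul, ← zpow_natCast, ← zpow_natCast p 2,
      ← zpow_add₀ hp, ← zpow_add₀ hp]
    push_cast
    ring_nf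
  have e3 : (-1 : ℂ) ^ (3 * i + 1) = -(-1) ^ i := by
    rw [pow_succ, pow_mul]; norm_num
  rw [derivAt_mul, aeval_shiftedCentralGauss hprim (Nat.le_add_left 1 (3 * i)) h, mul_zero,
    zero_add, map_pow, aeval_X, eq_div_of_mul_eq h1 hg, thetaQuotient, e1, e3, zpow_natCast]
  rw [mul_div_assoc', mul_div_assoc']
  congr 1
  linear_combination -(2 * n * (-1 : ℂ) ^ i) * e2

/-- The class `d = 3i + 2` supplies the negative indices, since `6 * (-1 - i) + 2 = -2 * d`. -/
theorem derivAt_X_pow_mul_shiftedCentralGauss_two (hp : p ≠ 0) (hpn : p ^ n = -1)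
    (hprim : IsPrimitiveRoot (p ^ 2) n) {i : ℕ} (h : 3 * i + 2 < n) :
    derivAt (p ^ 2) (X ^ (6 * i ^ 2 + 9 * i + 3) * shiftedCentralGauss n (3 * i + 2)) =
      2 * n / p ^ 2 * thetaQuotient p (-1 - i) := by
  have hg := derivAt_shiftedCentralGauss hp hpn hprim (Nat.le_add_left 1 (3 * i + 1)) h
  have hx1 : 1 - p ^ (2 * (3 * i + 2)) ≠ 0 := by
    rw [pow_mul]
    exact sub_ne_zero.2 (hprim.pow_ne_one_of_pos_of_lt (by omega) h).symm
  have e1 : p ^ (6 * (-1 - (i : ℤ)) + 2) = (p ^ (2 * (3 * i + 2)))⁻¹ := by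
    rw [← zpow_natCast, ← zpow_neg]; push_cast; ring_nf
  have e2 : (p ^ 2) ^ (6 * i ^ 2 + 9 * i + 3) *
      p ^ (-2 - ((3 * i + 2 : ℕ) : ℤ) * ((3 * i + 2 : ℕ) - 1)) =
      p ^ (3 * (-1 - (i : ℤ)) * (-1 - i + 1)) * p ^ (2 * (3 * i + 2)) / p ^ 2 := by
    rw [eq_div_iff (pow_ne_zero _ hp), ← pow_mul, ← zpow_natCast, ← zpow_natCast p 2,
      ← zpow_natCast p (2 * (3 * i + 2)), ← zpow_add₀ hp, ← zpow_add₀ hp, ← zpow_add₀ hp]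
    push_cast
    ring_nf
  have e3 : (-1 : ℂ) ^ (3 * i + 2) = (-1) ^ i := by
    rw [pow_add, pow_mul]; norm_num
  have e4 : (-1 : ℂ) ^ (-1 - (i : ℤ)) = -(-1) ^ i := by
    rw [neg_one_zpow_sub]; norm_num
  rw [derivAt_mul, aeval_shiftedCentralGauss hprim (Nat.le_add_left 1 (3 * i + 1)) h, mul_zero,
    zero_add, map_pow, aeval_X, eq_div_of_mul_eq hx1 hg, thetaQuotient, e1, e3, e4]
  have hx : p ^ (2 * (3 * i + 2)) ≠ 0 := pow_ne_zero _ hp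
  generalize p ^ (2 * (3 * i + 2)) = x at *
  have e5 : 1 - x⁻¹ = -(1 - x) / x := by field_simp; ring
  rw [e5, div_div_eq_mul_div, div_neg, mul_neg, mul_div_assoc', mul_div_assoc', ← neg_div]
  congr 1
  linear_combination (2 * n * (-1 : ℂ) ^ i) * e2

theorem aeval_sum_shiftedCentralGauss {z : ℂ} (hz : IsPrimitiveRoot z n) {m : ℕ} (h : 3 * m ≤ n) :
    aeval z (∑ i ∈ Finset.range m,
      (X ^ (6 * i ^ 2 + 3 * i) * shiftedCentralGauss n (3 * i + 1) -
        X ^ (6 * i ^ 2 + 9 * i + 3) * shiftedCentralGauss n (3 * i + 2))) = 0 := by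
  rw [map_sum]
  refine Finset.sum_eq_zero fun i hi => ?_
  rw [Finset.mem_range] at hi
  rw [map_sub, map_mul, map_mul, aeval_shiftedCentralGauss hz (by omega) (by omega),
    aeval_shiftedCentralGauss hz (by omega) (by omega)]
  simp

theorem derivAt_sum_shiftedCentralGauss (hp : p ≠ 0) (hpn : p ^ n = -1)
    (hprim : IsPrimitiveRoot (p ^ 2) n) {m : ℕ} (h : 3 * m ≤ n) :
    derivAt (p ^ 2) (∑ i ∈ Finset.range m,
      (X ^ (6 * i ^ 2 + 3 * i) * shiftedCentralGauss n (3 * i + 1) -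
        X ^ (6 * i ^ 2 + 9 * i + 3) * shiftedCentralGauss n (3 * i + 2))) =
      -(2 * n / p ^ 2) *
        ∑ i ∈ Finset.range m, (thetaQuotient p i + thetaQuotient p (-1 - i)) := by
  rw [map_sum, Finset.mul_sum]
  refine Finset.sum_congr rfl fun i hi => ?_
  rw [Finset.mem_range] at hi
  rw [map_sub, derivAt_X_pow_mul_shiftedCentralGauss_one hp hpn hprim (by omega),
    derivAt_X_pow_mul_shiftedCentralGauss_two hp hpn hprim (by omega)]
  ring

end RootOfUnity

/-! ### The congruence, by residue of `n` modulo 3 -/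

theorem sq_cyclotomic_dvd_sum_central_gaussBinom_sub (n : ℕ) (hn : 0 < n) :
    cyclotomic n ℤ ^ 2 ∣ ∑ k ∈ Finset.range n, X ^ k * gaussBinom (2 * k) k -
      C (legendreSym 3 (n : ℤ)) * X ^ ((n ^ 2 - 1) / 3) := by
  refine sq_cyclotomic_dvd hn fun z hz => ?_
  obtain ⟨p, rfl, hpn⟩ := exists_sq_eq_and_pow_eq_neg_one hn hz
  have hp2 : p ^ 2 ≠ 0 := hz.ne_zero hn.ne'
  have hp : p ≠ 0 := by rintro rfl; simp at hp2
  have hz1 : (p ^ 2) ^ n = 1 := hz.pow_eq_one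
  obtain ⟨m, hm | hm | hm⟩ : ∃ m, n = 3 * m ∨ n = 3 * m + 1 ∨ n = 3 * m + 2 :=
    ⟨n / 3, by omega⟩
  · have hχ : legendreSym 3 (n : ℤ) = 0 := by
      rw [legendreSym.eq_zero_iff]
      rw [hm]; push_cast
      rw [show (3 : ZMod 3) = 0 from rfl, zero_mul]
    rw [hχ, C_0, zero_mul, sub_zero, sum_X_pow_mul_central_gaussBinom hm.le,
      aeval_sum_shiftedCentralGauss hz hm.ge, derivAt_sum_shiftedCentralGauss hp hpn hz hm.ge,
      sum_thetaQuotient_three_mul hp m (hm ▸ hpn), mul_zero]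
    exact ⟨rfl, rfl⟩
  · have hχ : legendreSym 3 (n : ℤ) = 1 := by
      rw [legendreSym.mod, hm, show ((3 * m + 1 : ℕ) : ℤ) % (3 : ℕ) = 1 by omega]
      decide
    have he : (n ^ 2 - 1) / 3 = 3 * m ^ 2 + 2 * m := by
      rw [hm, show (3 * m + 1) ^ 2 = 3 * (3 * m ^ 2 + 2 * m) + 1 by ring]
      omega
    have hA1 : shiftedCentralGauss n (3 * m + 1) = 1 := by rw [← hm, shiftedCentralGauss_self]
    have hA2 : shiftedCentralGauss n (3 * m + 2) = 0 :=
      shiftedCentralGauss_eq_zero_of_lt (by omega)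
    -- The exponents differ by `n * m`: equal values at `z`, but derivatives apart by `n * m * z ^ e
    -- / z` with `e = (n ^ 2 - 1) / 3`, which the theta block cancels.
    have hpow : (p ^ 2) ^ (6 * m ^ 2 + 3 * m) = (p ^ 2) ^ (3 * m ^ 2 + 2 * m) := by
      rw [show 6 * m ^ 2 + 3 * m = n * m + (3 * m ^ 2 + 2 * m) by rw [hm]; ring,
        pow_add _ (n * m), pow_mul _ n m, hz1, one_pow, one_mul]
    have hS := sum_thetaQuotient_three_mul_add_one hp m (hm ▸ hpn) (hm ▸ hz)
    rw [pow_mul] at hS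
    rw [hχ, he, C_1, one_mul, sum_X_pow_mul_central_gaussBinom (M := m + 1) (by omega),
      Finset.sum_range_succ, hA1, hA2, mul_zero, sub_zero, mul_one]
    constructor
    · rw [map_sub, map_add, aeval_sum_shiftedCentralGauss hz (by omega)]
      simp [hpow]
    · rw [map_sub, map_add, derivAt_sum_shiftedCentralGauss hp hpn hz (by omega),
        derivAt_X_pow hp2, derivAt_X_pow hp2, hpow]
      have hn' : (n : ℂ) = 3 * m + 1 := by rw [hm]; push_cast; ring
      push_cast
      linear_combination (-(n : ℂ) / p ^ 2) * hS -
        m * (p ^ 2) ^ (3 * m ^ 2 + 2 * m) / p ^ 2 * hn'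
  · have hχ : legendreSym 3 (n : ℤ) = -1 := by
      rw [legendreSym.mod, hm, show ((3 * m + 2 : ℕ) : ℤ) % (3 : ℕ) = 2 by omega]
      decide
    have he : (n ^ 2 - 1) / 3 = 3 * m ^ 2 + 4 * m + 1 := by
      rw [hm, show (3 * m + 2) ^ 2 = 3 * (3 * m ^ 2 + 4 * m + 1) + 1 by ring]
      omega
    have hA2 : shiftedCentralGauss n (3 * m + 2) = 1 := by rw [← hm, shiftedCentralGauss_self]
    have hpow : (p ^ 2) ^ (6 * m ^ 2 + 9 * m + 3) = (p ^ 2) ^ (3 * m ^ 2 + 4 * m + 1) := by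
      rw [show 6 * m ^ 2 + 9 * m + 3 = n * (m + 1) + (3 * m ^ 2 + 4 * m + 1) by rw [hm]; ring,
        pow_add _ (n * (m + 1)), pow_mul _ n (m + 1), hz1, one_pow, one_mul]
    have hS := sum_thetaQuotient_three_mul_add_two hp m (hm ▸ hpn) (hm ▸ hz)
    rw [pow_mul] at hS
    -- The block `i = m` holds both `d = n - 1`, the unpaired theta term, and `d = n`.
    rw [hχ, he, C_neg, C_1, neg_one_mul, sum_X_pow_mul_central_gaussBinom (M := m + 1) (by omega),
      Finset.sum_range_succ, hA2, mul_one, sub_neg_eq_add]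
    constructor
    · rw [map_add, map_add, aeval_sum_shiftedCentralGauss hz (by omega), map_sub, map_mul,
        aeval_shiftedCentralGauss hz (by omega) (by omega)]
      simp [hpow]
    · rw [map_add, map_add, derivAt_sum_shiftedCentralGauss hp hpn hz (by omega), map_sub,
        derivAt_X_pow_mul_shiftedCentralGauss_one hp hpn hz (by omega),
        derivAt_X_pow hp2, derivAt_X_pow hp2, hpow]
      have hn' : (n : ℂ) = 3 * m + 2 := by rw [hm]; push_cast; ring
      push_cast
      linear_combination (-(n : ℂ) / p ^ 2) * hS +
        (m + 1) * (p ^ 2) ^ (3 * m ^ 2 + 4 * m + 1) / p ^ 2 * hn'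

/-- The sum `∑_{k < n} q ^ k [2k choose k]_q`, formed in the field of rational functions in the
indeterminate `q`, is a polynomial `S` in `ℤ[q]`, and `S` is congruent to
`(n / 3) q ^ ((n ^ 2 - 1) / 3)` modulo `Φ_n(q) ^ 2` in `ℤ[q]`. (When `3 ∣ n` the Legendre symbol,
hence the right-hand side, is `0`; otherwise the division in the exponent is exact.) -/
theorem theorem1p2 (n : ℕ) (hn : 0 < n) :
    ∃ S : Polynomial ℤ,
      algebraMap (Polynomial ℤ) (RatFunc ℤ) S =
        ∑ k ∈ Finset.range n,
          (RatFunc.X : RatFunc ℤ) ^ k * qBinomial (RatFunc.X : RatFunc ℤ) (2 * k) k ∧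
      Polynomial.cyclotomic n ℤ ^ 2 ∣
        S - Polynomial.C (legendreSym 3 (n : ℤ)) * Polynomial.X ^ ((n ^ 2 - 1) / 3) := by
  refine ⟨_, ?_, sq_cyclotomic_dvd_sum_central_gaussBinom_sub n hn⟩
  simp [algebraMap_gaussBinom_two_mul]
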